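/- For $T\in\mathbb N$, outcomes $x\in\{0,1\}^T$ and predictions $p\in[0,1]^T$, define the Subsampled Smooth Calibration Error $$\mathsf{SSCE}(x,p)=\mathbb E_{S\sim\mathrm{Unif}(2^{[T]})}\Big[\sup_{f\in\mathcal F}\sum_{t\in S} f(p_t)(x_t-p_t)\Big],$$ where $\mathcal F$ is the family of $1$-Lipschitz functions from $[0,1]$ to $[-1,1]$. In the adversarial sequential calibration setting with horizon $T$, at each step $t=1,\dots,T$ the forecaster makes a prediction $p_t\in[0,1]$ and an adaptive adversary, who has observed the earlier outcomes $x_1,\dots,x_{t-1}$ and predictions $p_1,\dots,p_{t-1}$, chooses the outcome $x_t\in\{0,1\}$, possibly at random. A deterministic forecaster chooses $p_t$ as a function of $x_1,\dots,x_{t-1}$. **Theorem.** There is a universal constant $C>0$ such that for every $T\in\mathbb N$ there is a deterministic forecaster for horizon $T$ such that, against every adaptive adversary, the resulting outcomes $x$ and predictions $p$ satisfy, with probability $1$, $$\mathsf{SSCE}(x,p)\le C\sqrt T.$$ -/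

import Mathlib

namespace SeqCalibration

noncomputable section

/-- The real value `1` or `0` of a binary outcome. -/
def bit (b : Bool) : ℝ := if b then 1 else 0

/-- The family of `1`-Lipschitz functions from `[0, 1]` to `[-1, 1]`. -/
abbrev LipFamily : Type :=
  {f : unitInterval → Set.Icc (-1 : ℝ) 1 // LipschitzWith 1 f}

/-- Smooth calibration error of outcomes `x` and predictions `p` on a finite set `ι` of time
steps: the supremum of `∑ f (p t) * (x t - p t)` over `1`-Lipschitz `f : [0, 1] → [-1, 1]`. The
supremum is over a nonempty family that is bounded above, see `smCE_bddAbove`. -/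
def smCE {ι : Type} [Fintype ι] (x : ι → Bool) (p : ι → unitInterval) : ℝ :=
  ⨆ f : LipFamily, ∑ t : ι, (f.1 (p t) : ℝ) * (bit (x t) - (p t : ℝ))

/-- The supremum that defines `smCE` is over a bounded set of reals. -/
theorem smCE_bddAbove {ι : Type} [Fintype ι] (x : ι → Bool) (p : ι → unitInterval) :
    BddAbove (Set.range fun f : LipFamily =>
      ∑ t : ι, (f.1 (p t) : ℝ) * (bit (x t) - (p t : ℝ))) := by
  refine ⟨∑ _t : ι, (1 : ℝ), ?_⟩
  rintro _ ⟨f, rfl⟩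
  refine Finset.sum_le_sum fun t _ => ?_
  have h1 := (f.1 (p t)).2.1
  have h2 := (f.1 (p t)).2.2
  have h3 := (p t).2.1
  have h4 := (p t).2.2
  cases hx : x t <;> simp only [bit] <;> norm_num <;> nlinarith

/-- Subsampled smooth calibration error: the expectation, over a uniformly random set `S` of time
steps, of the smooth calibration error of `x` and `p` restricted to `S`. -/
def SSCE {T : ℕ} (x : Fin T → Bool) (p : Fin T → unitInterval) : ℝ :=
  (∑ S : Finset (Fin T), smCE (fun t : S => x t) (fun t : S => p t)) / 2 ^ T

/-- A deterministic forecaster for horizon `T`: at each time step (numbered from `0`), a prediction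
in `[0, 1]` as a function of the earlier outcomes. -/
abbrev Forecaster (T : ℕ) : Type := (t : Fin T) → (Fin t → Bool) → unitInterval

/-- An adaptive, possibly randomized, adversary for horizon `T`: at each time step, a
distribution on outcomes as a function of the earlier outcomes and the earlier predictions.
Point masses give the deterministic adversaries. -/
abbrev Adversary (T : ℕ) : Type :=
  (t : Fin T) → (Fin t → Bool) → (Fin t → unitInterval) → PMF Bool

/-- The predictions that the forecaster makes in the first `t` steps if the outcomes of
these steps are `x`. -/
def Forecaster.predictions {T : ℕ} (A : Forecaster T) {t : ℕ} (ht : t ≤ T)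
    (x : Fin t → Bool) : Fin t → unitInterval :=
  fun s => A (Fin.castLE ht s) (fun i => x (Fin.castLE s.isLt.le i))

/-- The law of the first `t` outcomes when the forecaster `A` plays against the adversary `B`. -/
def outcomeLaw {T : ℕ} (A : Forecaster T) (B : Adversary T) :
    (t : ℕ) → t ≤ T → PMF (Fin t → Bool)
  | 0, _ => PMF.pure Fin.elim0
  | t + 1, ht =>
    (outcomeLaw A B t (Nat.le_of_succ_le ht)).bind fun x =>
      (B ⟨t, ht⟩ x (A.predictions (Nat.le_of_succ_le ht) x)).map fun b =>
        (Fin.snoc x b : Fin (t + 1) → Bool)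

end

end SeqCalibration

/-!
The forecaster is deterministic, so every outcome sequence has a single prediction sequence, and it
suffices to bound `SSCE` for each outcome sequence separately. All predictions lie on the grid
`0, 1/m, …, 1` with `m = ⌈√T⌉`.

*Smooth calibration.* For every grid point `i/m` keep a bias: the sum of `x s - i/m` over the steps
`s` charged to that point. Since the bias of `0` is nonnegative and that of `1` is nonpositive, there
is a crossing: adjacent points `i/m`, `(i+1)/m` with bias `≥ 0` and `≤ 0` respectively. The forecaster
predicts `i/m`; once the outcome is known, the step is charged to `i/m` if the outcome is `0` and to
`(i+1)/m` if it is `1`. Either way a bias moves towards zero by at most `1`, so all biases stay in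
`[-1, 1]` (`SeqCalibration.bias_invariant`). A Lipschitz test function sees the charged sequence
with total error at most `m + 1`, and moving from charged points to predictions costs at most `2/m`
per step (`SeqCalibration.sum_lipschitz_mul_le`).

*Subsampling.* A subset sum is half the total sum plus a sum with signs `± 1/2`. By summation by
parts along the grid, the signed sum of a test function is at most the absolute signed sum of the
weights plus the average over thresholds `j` of the absolute signed sums of the weights above `j`
(`SeqCalibration.sum_mul_le_of_small_increments`). This bound does not depend on the test function,
so the supremum passes inside for free, and each of these random sums has mean absolute value at
most `√T / 2` by its second moment (`SeqCalibration.sum_abs_signed_sum_le`).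
-/

namespace SeqCalibration

noncomputable section

/-! ### Random subset sums -/

/-- The centred indicator of membership of `t` in `S`; for a uniformly random `S` it takes the
values `1/2` and `-1/2` with equal probability. -/
def centredIndicator {ι : Type*} [DecidableEq ι] (S : Finset ι) (t : ι) : ℝ :=
  if t ∈ S then 1 / 2 else -(1 / 2)

theorem sum_powerset_sq_signed_sum {ι : Type*} [DecidableEq ι] (U : Finset ι) (a : ι → ℝ) :
    ∑ S ∈ U.powerset, (∑ t ∈ U, centredIndicator S t * a t) ^ 2 =
      2 ^ U.card * ((∑ t ∈ U, a t ^ 2) / 4) := by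
  induction U using Finset.induction_on with
  | empty => simp
  | insert u U hu ih =>
    have h : ∀ S ∈ U.powerset,
        (∑ t ∈ insert u U, centredIndicator S t * a t) ^ 2 +
          (∑ t ∈ insert u U, centredIndicator (insert u S) t * a t) ^ 2 =
        2 * (∑ t ∈ U, centredIndicator S t * a t) ^ 2 + a u ^ 2 / 2 := by
      intro S hS
      have huS : u ∉ S := fun h => hu (Finset.mem_powerset.1 hS h)
      have hins : ∑ t ∈ U, centredIndicator (insert u S) t * a t =
          ∑ t ∈ U, centredIndicator S t * a t := by
        refine Finset.sum_congr rfl fun t ht => ?_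
        have htu : t ≠ u := fun h => hu (h ▸ ht)
        simp [centredIndicator, htu]
      rw [Finset.sum_insert hu, Finset.sum_insert hu, hins]
      simp only [centredIndicator, huS, Finset.mem_insert_self, if_true, if_false]
      ring
    rw [Finset.sum_powerset_insert hu, ← Finset.sum_add_distrib, Finset.sum_congr rfl h,
      Finset.sum_add_distrib, ← Finset.mul_sum, ih, Finset.sum_insert hu,
      Finset.card_insert_of_notMem hu]
    simp only [Finset.sum_const, Finset.card_powerset, nsmul_eq_mul]
    push_cast
    ring

/-- First moment bound, from the second moment by the Cauchy–Schwarz inequality. -/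
theorem sum_abs_signed_sum_le {ι : Type*} [Fintype ι] [DecidableEq ι] (a : ι → ℝ)
    (ha : ∀ t, |a t| ≤ 1) :
    ∑ S : Finset ι, |∑ t, centredIndicator S t * a t| ≤
      2 ^ Fintype.card ι * (√(Fintype.card ι) / 2) := by
  have hcs := sq_sum_le_card_mul_sum_sq (s := (Finset.univ : Finset (Finset ι)))
    (f := fun S => |∑ t, centredIndicator S t * a t|)
  have hmoment := sum_powerset_sq_signed_sum Finset.univ a
  have hsq : ∑ t, a t ^ 2 ≤ Fintype.card ι := by
    calc ∑ t, a t ^ 2 ≤ ∑ _t : ι, (1 : ℝ) :=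
          Finset.sum_le_sum fun t _ => (sq_le_one_iff_abs_le_one _).2 (ha t)
      _ = Fintype.card ι := by simp
  simp only [sq_abs, Finset.card_univ, Fintype.card_finset, Finset.powerset_univ] at hcs hmoment
  rw [hmoment] at hcs
  refine abs_le_of_sq_le_sq' ?_ (by positivity) |>.2
  refine hcs.trans ?_
  rw [mul_pow, div_pow, Real.sq_sqrt (Nat.cast_nonneg _)]
  push_cast
  have h2 : (0 : ℝ) ≤ 2 ^ Fintype.card ι * 2 ^ Fintype.card ι := by positivity
  nlinarith

/-- Summation by parts along a grid: a function on `{0, …, m}` that is bounded by `1` at `0` and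
has increments at most `1 / m` is tested against weights `c` by their total and by their tails. -/
theorem sum_mul_le_of_small_increments {ι : Type*} [Fintype ι] (c : ι → ℝ) (k : ι → ℕ) (m : ℕ)
    (hk : ∀ t, k t ≤ m) (F : ℕ → ℝ) (h0 : |F 0| ≤ 1)
    (hF : ∀ j < m, |F (j + 1) - F j| ≤ 1 / m) :
    ∑ t, c t * F (k t) ≤
      |∑ t, c t| + (∑ j ∈ Finset.range m, |∑ t, c t * if j < k t then 1 else 0|) / m := by
  have hF' : ∀ t, F (k t) =
      F 0 + ∑ j ∈ Finset.range m, (F (j + 1) - F j) * if j < k t then 1 else 0 := by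
    intro t
    have hfilter : (Finset.range m).filter (· < k t) = Finset.range (k t) := by
      ext j
      have := hk t
      simp only [Finset.mem_filter, Finset.mem_range]
      omega
    simp only [mul_ite, mul_one, mul_zero]
    rw [← Finset.sum_filter, hfilter, Finset.sum_range_sub]
    ring
  have hsum : ∑ t, c t * F (k t) = F 0 * ∑ t, c t +
      ∑ j ∈ Finset.range m, (F (j + 1) - F j) * ∑ t, c t * if j < k t then 1 else 0 := by
    simp only [Finset.mul_sum]
    rw [Finset.sum_comm, ← Finset.sum_add_distrib]
    refine Finset.sum_congr rfl fun t _ => ?_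
    rw [hF' t, mul_add, Finset.mul_sum, mul_comm]
    congr 1
    exact Finset.sum_congr rfl fun j _ => by ring
  rw [hsum, Finset.sum_div]
  refine add_le_add ?_ (Finset.sum_le_sum fun j hj => ?_)
  · refine (le_abs_self _).trans ?_
    rw [abs_mul]
    exact mul_le_of_le_one_left (abs_nonneg _) h0
  · refine (le_abs_self _).trans ?_
    rw [abs_mul, div_eq_mul_one_div, mul_comm]
    exact mul_le_mul_of_nonneg_left (hF j (Finset.mem_range.1 hj)) (abs_nonneg _)

/-! ### The grid -/

/-- The point `j / m` of `[0, 1]`, truncated to `1` for `j > m`. -/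
def gridPoint (m j : ℕ) : unitInterval := Set.projIcc 0 1 zero_le_one ((j : ℝ) / m)

theorem coe_gridPoint {m j : ℕ} (hj : j ≤ m) : (gridPoint m j : ℝ) = j / m := by
  have h : (j : ℝ) / m ∈ Set.Icc (0 : ℝ) 1 :=
    ⟨by positivity, div_le_one_of_le₀ (by exact_mod_cast hj) (by positivity)⟩
  rw [gridPoint, Set.projIcc_of_mem _ h]

theorem LipFamily.abs_le_one (f : LipFamily) (q : unitInterval) : |(f.1 q : ℝ)| ≤ 1 :=
  abs_le.2 (f.1 q).2

theorem LipFamily.abs_sub_le (f : LipFamily) (q r : unitInterval) :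
    |(f.1 q : ℝ) - f.1 r| ≤ |(q : ℝ) - r| := by
  have h := f.2.dist_le_mul q r
  rwa [NNReal.coe_one, one_mul, Subtype.dist_eq, Subtype.dist_eq, Real.dist_eq, Real.dist_eq] at h

theorem LipFamily.abs_gridPoint_succ_sub_le (f : LipFamily) {m j : ℕ} (hj : j < m) :
    |(f.1 (gridPoint m (j + 1)) : ℝ) - f.1 (gridPoint m j)| ≤ 1 / m := by
  refine (f.abs_sub_le _ _).trans_eq ?_
  rw [coe_gridPoint hj, coe_gridPoint hj.le, ← sub_div, Nat.cast_succ, add_sub_cancel_left,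
    abs_of_nonneg (by positivity)]

theorem abs_bit_sub_le_one (b : Bool) (q : unitInterval) : |bit b - (q : ℝ)| ≤ 1 := by
  have h0 := q.2.1
  have h1 := q.2.2
  cases b <;> simp only [bit] <;> rw [abs_le] <;> constructor <;> norm_num <;> linarith

instance : Nonempty LipFamily :=
  ⟨⟨fun _ => ⟨0, by norm_num⟩, LipschitzWith.const' _⟩⟩

/-! ### From smooth calibration to its subsampled version -/

/-- Predictions on a grid: a bound on the smooth calibration error over all steps bounds the
subsampled error, up to the fluctuation `√T` of random subset sums. -/
theorem SSCE_gridPoint_le {T m : ℕ} (hm : 0 < m) (x : Fin T → Bool) (k : Fin T → ℕ)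
    (hk : ∀ t, k t ≤ m) (M : ℝ)
    (hM : ∀ f : LipFamily,
      ∑ t, (f.1 (gridPoint m (k t)) : ℝ) * (bit (x t) - gridPoint m (k t)) ≤ M) :
    SSCE x (fun t => gridPoint m (k t)) ≤ M / 2 + √T := by
  let w : Fin T → ℝ := fun t => bit (x t) - gridPoint m (k t)
  have hw : ∀ t, |w t| ≤ 1 := fun t => abs_bit_sub_le_one _ _
  have hbound : ∀ S : Finset (Fin T),
      smCE (fun t : S => x t) (fun t : S => gridPoint m (k t)) ≤
        M / 2 + (|∑ t, centredIndicator S t * w t| +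
          (∑ j ∈ Finset.range m,
            |∑ t, centredIndicator S t * (w t * if j < k t then 1 else 0)|) / m) := by
    intro S
    refine ciSup_le fun f => ?_
    have hparts := sum_mul_le_of_small_increments (fun t => centredIndicator S t * w t) k m hk
      (fun j => f.1 (gridPoint m j)) (f.abs_le_one _) fun j hj => f.abs_gridPoint_succ_sub_le hj
    have hsplit : ∑ t : S, (f.1 (gridPoint m (k t)) : ℝ) * (bit (x t) - gridPoint m (k t)) =
        (∑ t, (f.1 (gridPoint m (k t)) : ℝ) * w t) / 2 +
          ∑ t, centredIndicator S t * w t * f.1 (gridPoint m (k t)) := by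
      rw [Finset.sum_coe_sort S fun t =>
          (f.1 (gridPoint m (k t)) : ℝ) * (bit (x t) - gridPoint m (k t)),
        Finset.sum_div, ← Finset.sum_add_distrib,
        ← Finset.univ_inter S, ← Finset.sum_ite_mem]
      refine Finset.sum_congr rfl fun t _ => ?_
      simp only [centredIndicator, Finset.univ_inter]
      split_ifs <;> simp only [w] <;> ring
    rw [hsplit]
    simp only [mul_assoc] at hparts ⊢
    exact add_le_add (by linarith [hM f]) hparts
  have hfirst := sum_abs_signed_sum_le w hw
  have hrest : ∀ j ∈ Finset.range m,
      ∑ S : Finset (Fin T), |∑ t, centredIndicator S t * (w t * if j < k t then 1 else 0)| ≤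
        2 ^ T * (√T / 2) := by
    intro j _
    refine (sum_abs_signed_sum_le _ fun t => ?_).trans_eq (by simp)
    split_ifs
    · simpa using hw t
    · simp
  rw [Fintype.card_fin] at hfirst
  have hm' : (0 : ℝ) < m := by exact_mod_cast hm
  rw [SSCE, div_le_iff₀ (by positivity)]
  refine (Finset.sum_le_sum fun S _ => hbound S).trans ?_
  rw [Finset.sum_add_distrib, Finset.sum_add_distrib, ← Finset.sum_div, ← Finset.sum_div,
    Finset.sum_comm]
  have havg : (∑ j ∈ Finset.range m,
      ∑ S : Finset (Fin T), |∑ t, centredIndicator S t * (w t * if j < k t then 1 else 0)|) / m ≤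
        2 ^ T * (√T / 2) := by
    rw [div_le_iff₀ hm']
    refine (Finset.sum_le_card_nsmul _ _ _ hrest).trans_eq ?_
    rw [Finset.card_range, nsmul_eq_mul, mul_comm]
  simp only [Finset.sum_const, Finset.card_univ, Fintype.card_finset, Fintype.card_fin,
    nsmul_eq_mul]
  push_cast
  linarith

/-! ### The forecaster -/

/-- The last grid index `i < m` of nonnegative bias, or `0` if there is none (which never happens for
the biases below, by `bias_invariant`). -/
def crossing (m : ℕ) (E : ℕ → ℝ) : ℕ := Nat.findGreatest (fun i => 0 ≤ E i) (m - 1)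

/-- The bias of each grid index after `t` steps on the outcome sequence `x`: the sum of `x s - i / m`
over the steps `s < t` that are charged to `i`. A step is charged to the crossing of the current
biases if its outcome is `0`, and to the index after it if its outcome is `1`. -/
def bias (m : ℕ) (x : ℕ → Bool) : ℕ → ℕ → ℝ
  | 0 => 0
  | t + 1 =>
    let k := crossing m (bias m x t) + (x t).toNat
    Function.update (bias m x t) k (bias m x t k + (bit (x t) - k / m))

/-- The grid index predicted at step `t`. -/
def predictedIndex (m : ℕ) (x : ℕ → Bool) (t : ℕ) : ℕ := crossing m (bias m x t)

/-- The grid index to which step `t` is charged after its outcome is known. -/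
def chargedIndex (m : ℕ) (x : ℕ → Bool) (t : ℕ) : ℕ := predictedIndex m x t + (x t).toNat

theorem bias_succ (m : ℕ) (x : ℕ → Bool) (t : ℕ) :
    bias m x (t + 1) = Function.update (bias m x t) (chargedIndex m x t)
      (bias m x t (chargedIndex m x t) + (bit (x t) - chargedIndex m x t / m)) := rfl

theorem bias_congr (m : ℕ) {x y : ℕ → Bool} (t : ℕ) (h : ∀ s < t, x s = y s) :
    bias m x t = bias m y t := by
  induction t with
  | zero => rfl
  | succ t ih =>
    simp only [bias, ih fun s hs => h s (hs.trans t.lt_succ_self), h t t.lt_succ_self]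

theorem crossing_lt {m : ℕ} (hm : 0 < m) (E : ℕ → ℝ) : crossing m E < m := by
  have := Nat.findGreatest_le (P := fun i => 0 ≤ E i) (m - 1)
  unfold crossing
  omega

theorem crossing_nonneg (m : ℕ) {E : ℕ → ℝ} (h0 : 0 ≤ E 0) : 0 ≤ E (crossing m E) :=
  Nat.findGreatest_spec (P := fun i => 0 ≤ E i) (Nat.zero_le (m - 1)) h0

theorem crossing_succ_nonpos {m : ℕ} (hm : 0 < m) {E : ℕ → ℝ} (h1 : E m ≤ 0) :
    E (crossing m E + 1) ≤ 0 := by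
  have hlt := crossing_lt hm E
  rcases (Nat.succ_le_of_lt hlt).eq_or_lt with h | h
  · rwa [← Nat.succ_eq_add_one, h]
  · exact (not_le.1 (Nat.findGreatest_is_greatest (P := fun i => 0 ≤ E i)
      (Nat.lt_succ_self (crossing m E)) (by omega))).le

theorem chargedIndex_le {m : ℕ} (hm : 0 < m) (x : ℕ → Bool) (t : ℕ) : chargedIndex m x t ≤ m := by
  have := crossing_lt hm (bias m x t)
  have := Bool.toNat_le (x t)
  unfold chargedIndex predictedIndex
  omega

/-- The endpoints of the grid keep biases of fixed sign because the bias of `0` moves only up and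
that of `m` only down; hence a crossing exists at every step, and each step moves a bias towards
zero by at most `1`. -/
theorem bias_invariant {m : ℕ} (hm : 0 < m) (x : ℕ → Bool) (t : ℕ) :
    0 ≤ bias m x t 0 ∧ bias m x t m ≤ 0 ∧ ∀ i, |bias m x t i| ≤ 1 := by
  induction t with
  | zero => simp [bias]
  | succ t ih =>
    obtain ⟨h0, h1, hb⟩ := ih
    have hk := chargedIndex_le hm x t
    have hm' : (0 : ℝ) < m := by exact_mod_cast hm
    have hkm : (chargedIndex m x t : ℝ) / m ≤ 1 :=
      div_le_one_of_le₀ (by exact_mod_cast hk) hm'.le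
    have hk0 : (0 : ℝ) ≤ chargedIndex m x t / m := by positivity
    rw [bias_succ]
    cases hx : x t with
    | false =>
      have hE : 0 ≤ bias m x t (chargedIndex m x t) := by
        simpa [chargedIndex, predictedIndex, hx] using crossing_nonneg m h0
      refine ⟨?_, ?_, fun i => ?_⟩ <;> rw [Function.update_apply] <;> split_ifs with h
      · simpa [← h, bit] using h0
      · exact h0
      · have := crossing_lt hm (bias m x t)
        simp only [chargedIndex, predictedIndex, hx, Bool.toNat_false] at h
        omega
      · exact h1
      · have := abs_le.1 (hb (chargedIndex m x t))
        simp only [bit, Bool.false_eq_true, if_false]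
        exact abs_le.2 ⟨by linarith, by linarith⟩
      · exact hb i
    | true =>
      have hE : bias m x t (chargedIndex m x t) ≤ 0 := by
        simpa [chargedIndex, predictedIndex, hx] using crossing_succ_nonpos hm h1
      refine ⟨?_, ?_, fun i => ?_⟩ <;> rw [Function.update_apply] <;> split_ifs with h
      · simp [chargedIndex, hx] at h
      · exact h0
      · simpa [← h, bit, hm.ne'] using h1
      · exact h1
      · have := abs_le.1 (hb (chargedIndex m x t))
        simp only [bit, if_true]
        exact abs_le.2 ⟨by linarith, by linarith⟩
      · exact hb i

theorem sum_charged_eq_sum_bias {m : ℕ} (hm : 0 < m) (x : ℕ → Bool) (g : ℕ → ℝ) (t : ℕ) :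
    ∑ s ∈ Finset.range t, g (chargedIndex m x s) * (bit (x s) - chargedIndex m x s / m) =
      ∑ i ∈ Finset.range (m + 1), g i * bias m x t i := by
  induction t with
  | zero => simp [bias]
  | succ t ih =>
    have hmem : chargedIndex m x t ∈ Finset.range (m + 1) :=
      Finset.mem_range.2 (Nat.lt_succ_of_le (chargedIndex_le hm x t))
    rw [Finset.sum_range_succ, ih, bias_succ, ← Finset.add_sum_erase _ _ hmem,
      ← Finset.add_sum_erase (Finset.range (m + 1)) _ hmem, Function.update_self]
    have : ∀ i ∈ (Finset.range (m + 1)).erase (chargedIndex m x t),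
        g i * Function.update (bias m x t) (chargedIndex m x t)
          (bias m x t (chargedIndex m x t) + (bit (x t) - chargedIndex m x t / m)) i =
        g i * bias m x t i := fun i hi => by
      rw [Function.update_of_ne (Finset.ne_of_mem_erase hi)]
    rw [Finset.sum_congr rfl this]
    ring

/-- The smooth calibration error of the predictions is at most `m + 1`, the total absolute bias,
plus `2 / m` for each step, the cost of moving it to the grid point it is charged to. -/
theorem sum_lipschitz_mul_le {m : ℕ} (hm : 0 < m) (x : ℕ → Bool) (f : LipFamily) (T : ℕ) :
    ∑ t ∈ Finset.range T, (f.1 (gridPoint m (predictedIndex m x t)) : ℝ) *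
        (bit (x t) - gridPoint m (predictedIndex m x t)) ≤ (m + 1) + T * (2 / m) := by
  have hstep : ∀ t ∈ Finset.range T, (f.1 (gridPoint m (predictedIndex m x t)) : ℝ) *
        (bit (x t) - gridPoint m (predictedIndex m x t)) ≤
      f.1 (gridPoint m (chargedIndex m x t)) * (bit (x t) - chargedIndex m x t / m) + 2 / m := by
    intro t _
    rw [← coe_gridPoint (chargedIndex_le hm x t)]
    set p := gridPoint m (predictedIndex m x t)
    set q := gridPoint m (chargedIndex m x t)
    have hpq : |(p : ℝ) - q| ≤ 1 / m := by
      simp only [p, q]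
      rw [predictedIndex, coe_gridPoint (crossing_lt hm _).le, coe_gridPoint (chargedIndex_le hm x t),
        ← sub_div, abs_div, Nat.abs_cast]
      gcongr
      cases hx : x t <;> simp [chargedIndex, predictedIndex, hx]
    have h1 : ((f.1 p : ℝ) - f.1 q) * (bit (x t) - p) ≤ 1 / m := by
      refine (le_abs_self _).trans ?_
      rw [abs_mul]
      exact (mul_le_of_le_one_right (abs_nonneg _) (abs_bit_sub_le_one _ _)).trans
        ((f.abs_sub_le p q).trans hpq)
    have h2 : (f.1 q : ℝ) * (q - p) ≤ 1 / m := by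
      refine (le_abs_self _).trans ?_
      rw [abs_mul, abs_sub_comm]
      exact (mul_le_of_le_one_left (abs_nonneg _) (f.abs_le_one _)).trans hpq
    have h3 : (2 : ℝ) / m = 1 / m + 1 / m := by ring
    linarith
  have hbias : ∀ i ∈ Finset.range (m + 1),
      (f.1 (gridPoint m i) : ℝ) * bias m x T i ≤ 1 := by
    intro i _
    refine (le_abs_self _).trans ?_
    rw [abs_mul]
    exact mul_le_one₀ (f.abs_le_one _) (abs_nonneg _) ((bias_invariant hm x T).2.2 i)
  refine (Finset.sum_le_sum hstep).trans ?_
  rw [Finset.sum_add_distrib, sum_charged_eq_sum_bias hm x (fun i => (f.1 (gridPoint m i) : ℝ))]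
  refine add_le_add ((Finset.sum_le_card_nsmul _ _ _ hbias).trans_eq (by simp)) ?_
  simp

/-- A finite outcome sequence continued by zeros. -/
def extendOutcomes {t : ℕ} (x : Fin t → Bool) : ℕ → Bool :=
  fun s => if h : s < t then x ⟨s, h⟩ else false

/-- The forecaster that predicts the crossing of the biases on a grid of mesh `1 / m`. -/
def crossingForecaster (m T : ℕ) : Forecaster T :=
  fun t x => gridPoint m (predictedIndex m (extendOutcomes x) t)

theorem crossingForecaster_predictions (m : ℕ) {T : ℕ} (x : Fin T → Bool) :
    (crossingForecaster m T).predictions le_rfl x =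
      fun t : Fin T => gridPoint m (predictedIndex m (extendOutcomes x) t) := by
  funext t
  simp only [Forecaster.predictions, crossingForecaster, predictedIndex]
  congr 2
  refine bias_congr m _ fun s hs => ?_
  have hs' : s < (t : ℕ) := hs
  simp [extendOutcomes, hs', hs'.trans t.isLt]

theorem SSCE_crossingForecaster_le {m : ℕ} (hm : 0 < m) {T : ℕ} (x : Fin T → Bool) :
    SSCE x ((crossingForecaster m T).predictions le_rfl x) ≤
      ((m + 1) + T * (2 / m)) / 2 + √T := by
  rw [crossingForecaster_predictions]
  refine SSCE_gridPoint_le hm x (fun t => predictedIndex m (extendOutcomes x) t)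
    (fun t => (crossing_lt hm _).le) _ fun f => ?_
  refine le_of_eq_of_le ?_ (sum_lipschitz_mul_le hm (extendOutcomes x) f T)
  rw [Finset.sum_range]
  exact Finset.sum_congr rfl fun t _ => by simp [extendOutcomes]

end

end SeqCalibration

theorem theorem1p3 :
    ∃ C : ℝ, 0 < C ∧ ∀ T : ℕ, ∃ A : SeqCalibration.Forecaster T,
      ∀ B : SeqCalibration.Adversary T,
        ∀ x ∈ (SeqCalibration.outcomeLaw A B T le_rfl).support,
          SeqCalibration.SSCE x (A.predictions le_rfl x) ≤ C * Real.sqrt T := by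
  -- Mesh `1 / √T` balances the `m + 1` grid biases against the rounding cost `2 * T / m`.
  refine ⟨4, by norm_num, fun T => ⟨SeqCalibration.crossingForecaster ⌈√(T : ℝ)⌉₊ T, ?_⟩⟩
  intro _ x _
  rcases Nat.eq_zero_or_pos T with rfl | hT
  · simp [SeqCalibration.SSCE, SeqCalibration.smCE]
  have hT1 : (1 : ℝ) ≤ √T := Real.one_le_sqrt.2 (by exact_mod_cast hT)
  have hm : 0 < ⌈√(T : ℝ)⌉₊ := Nat.ceil_pos.2 (by linarith)
  refine (SeqCalibration.SSCE_crossingForecaster_le hm x).trans ?_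
  have hle : √(T : ℝ) ≤ (⌈√(T : ℝ)⌉₊ : ℝ) := Nat.le_ceil _
  have hlt : (⌈√(T : ℝ)⌉₊ : ℝ) < √T + 1 := Nat.ceil_lt_add_one (by positivity)
  have hdiv : (T : ℝ) * (2 / ⌈√(T : ℝ)⌉₊) ≤ 2 * √T := by
    rw [mul_div_assoc', div_le_iff₀ (by exact_mod_cast hm)]
    nlinarith [Real.mul_self_sqrt (Nat.cast_nonneg (α := ℝ) T)]
  linarith
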